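/- Let $q$ be a prime power, let $n,k$ be integers with $1\le k\le n-1$, and for a linear code $C\subseteq\mathbb F_{q^2}^n$ let $$C^{\perp_H}=\Big\{y\in\mathbb F_{q^2}^n:\ \sum_{i=1}^n x_iy_i^q=0\ \text{ for all }x\in C\Big\},\qquad \mathrm{Hull}_H(C)=C\cap C^{\perp_H}.$$ Let $A^H_{n,k,\ell,q}$ be the number of $k$-dimensional linear codes $C\subseteq\mathbb F_{q^2}^n$ with $\dim\mathrm{Hull}_H(C)=\ell$. The entanglement-assisted quantum error-correcting code (EAQECC) that the Hermitian construction of Guenda, Jitman and Gulliver attaches to $C$ uses $\operatorname{rank}(HH^\dagger)$ maximally entangled pairs, where $H$ is an $(n-k)\times n$ parity check matrix of $C$ (a matrix with linearly independent rows and $C=\{x: Hx=0\}$) and $H^\dagger$ is the transpose of the entrywise $q$-th power of $H$. 1. If $\dim C=k$ and $\dim\mathrm{Hull}_H(C)=\ell$, then $\operatorname{rank}(HH^\dagger)=c:=n-k-\ell$ for every such parity check matrix $H$. Hence, whenever $c+k+\ell=n$ with $c,\ell\ge 0$, $A^H_{n,k,\ell,q}$ is the number of $k$-dimensional codes in $\mathbb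 F_{q^2}^n$ whose EAQECC uses exactly $c$ maximally entangled pairs. 2. (Ratio decomposition.) For all integers $\ell\ge 0$ with $\ell+1\le k\le n-\ell-1$, put $a=k-\ell$ and $b=n-k-\ell$. Then $$A^H_{n,k,\ell,q}=\alpha^H_{n,k,\ell,q}\,(q^{\ell+1}-1)\,A^H_{n,k,\ell+1,q},\qquad \alpha^H_{n,k,\ell,q}=\frac{q^{n-2\ell-1}(q^{\ell+1}+1)}{(q^a-(-1)^a)(q^b-(-1)^b)}.$$ Moreover $\alpha^H_{n,k,\ell,q}>1$ except when $\ell=0$, $n$ is even and $k\in\{1,n-1\}$, in which case $\alpha^H_{n,k,0,q}=q^{\max(a,b)}/(q^{\max(a,b)}+1)<1$; in all cases $\alpha^H_{n,k,\ell,q}\ge q/(q+1)\ge 2/3$. 3. (Monotonicity.) For all $\ell\ge 0$ with $\ell+1\le k\le n-\ell-1$, we have $A^H_{n,k,\ell+1,q}<A^H_{n,k,\ell,q}$, unless $q=2$, $\ell=0$, $n$ is even and $k\in\{1,n-1\}$. Consequently, unless $q=2$, $n$ is even and $k\in\{1,n-1\}$, the count $A^H_{n,k,\ell,q}$ is strictly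 decreasing in $\ell$ for $0\le\ell\le\min(k,n-k)$; equivalently, the number of $k$-dimensional codes in $\mathbb F_{q^2}^n$ whose EAQECC uses exactly $c$ maximally entangled pairs is strictly increasing in $c=n-k-\ell$ over the corresponding range of $c$. -/

import Mathlib

namespace HermitianCode

/-- In a field with `q ^ 2` elements, `x ↦ x ^ q` is additive. -/
theorem add_pow_of_card_eq_sq {K : Type*} [Field K] [Fintype K] {q : ℕ}
    (hK : Fintype.card K = q ^ 2) (x y : K) : (x + y) ^ q = x ^ q + y ^ q := by
  obtain ⟨p, hchar⟩ := CharP.exists K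
  obtain ⟨m, hm⟩ := FiniteField.card K p
  have : Fact p.Prime := ⟨hm.1⟩
  have hq : q ∣ p ^ (m : ℕ) := by
    rw [← hm.2, hK]
    exact Dvd.intro_left (q ^ (2 - 1)) (by ring)
  obtain ⟨j, -, rfl⟩ := (Nat.dvd_prime_pow hm.1).1 hq
  exact add_pow_char_pow x y p j

theorem pos_of_card_eq_sq {K : Type*} [Field K] [Fintype K] {q : ℕ}
    (hK : Fintype.card K = q ^ 2) : q ≠ 0 := by
  rintro rfl
  have := Fintype.card_pos (α := K)
  omega

/-- The Hermitian inner product `⟨x, y⟩_H = ∑ i, x i * (y i) ^ q` on `K ^ n`,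
where `K` is the field with `q ^ 2` elements. -/
def hermInner {K : Type*} [Field K] (q : ℕ) {n : ℕ} (x y : Fin n → K) : K :=
  ∑ i, x i * y i ^ q

/-- The Hermitian dual `{y | ∀ x ∈ C, ⟨x, y⟩_H = 0}` of a linear code `C`. -/
def hermDual {K : Type*} [Field K] [Fintype K] {q : ℕ} (hK : Fintype.card K = q ^ 2)
    {n : ℕ} (C : Submodule K (Fin n → K)) : Submodule K (Fin n → K) where
  carrier := {y | ∀ x ∈ C, hermInner q x y = 0}
  zero_mem' := by
    intro x _
    simp [hermInner, zero_pow (pos_of_card_eq_sq hK)]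
  add_mem' := by
    intro y z hy hz x hx
    have h1 := hy x hx
    have h2 := hz x hx
    simp only [hermInner, Pi.add_apply, add_pow_of_card_eq_sq hK, mul_add,
      Finset.sum_add_distrib] at h1 h2 ⊢
    rw [h1, h2, add_zero]
  smul_mem' := by
    intro c y hy x hx
    have h1 := hy x hx
    simp only [hermInner, Pi.smul_apply, smul_eq_mul, mul_pow] at h1 ⊢
    simp only [mul_left_comm _ (c ^ q), ← Finset.mul_sum, h1, mul_zero]

/-- The Hermitian hull of a linear code: its intersection with its Hermitian dual. -/
def hermHull {K : Type*} [Field K] [Fintype K] {q : ℕ} (hK : Fintype.card K = q ^ 2)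
    {n : ℕ} (C : Submodule K (Fin n → K)) : Submodule K (Fin n → K) :=
  C ⊓ hermDual hK C

/-- The number `A^H_{n,k,ℓ,q}` of `k`-dimensional linear codes of length `n` over the field `K`
with `q ^ 2` elements whose Hermitian hull has dimension `ℓ`. -/
noncomputable def numCodes {K : Type*} [Field K] [Fintype K] {q : ℕ}
    (hK : Fintype.card K = q ^ 2) (n k ℓ : ℕ) : ℕ :=
  Set.ncard {C : Submodule K (Fin n → K) |
    Module.finrank K C = k ∧ Module.finrank K (hermHull hK C) = ℓ}

/-- `H` is a parity check matrix of the linear code `C`: its rows are linearly independent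
and `C = {x | H x = 0}`. -/
def IsParityCheck {K : Type*} [Field K] {r n : ℕ} (H : Matrix (Fin r) (Fin n) K)
    (C : Submodule K (Fin n → K)) : Prop :=
  LinearIndependent K H.row ∧ ∀ x : Fin n → K, x ∈ C ↔ H.mulVec x = 0

/-- The number of maximally entangled pairs (ebits) used by the entanglement-assisted quantum
code that the Hermitian construction attaches to a classical code with parity check matrix `H`:
the rank of `H H†`, where `H†` is the transpose of the entrywise `q`-th power of `H`. -/
noncomputable def ebits {K : Type*} [Field K] (q : ℕ) {r n : ℕ}
    (H : Matrix (Fin r) (Fin n) K) : ℕ :=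
  (H * (H.map (fun a => a ^ q)).transpose).rank

/-- The number of `k`-dimensional linear codes of length `n` over `K` whose associated
entanglement-assisted quantum code needs exactly `c` ebits. -/
noncomputable def numCodesEbits (K : Type*) [Field K] (q n k c : ℕ) : ℕ :=
  Set.ncard {C : Submodule K (Fin n → K) |
    Module.finrank K C = k ∧
      ∃ H : Matrix (Fin (n - k)) (Fin n) K, IsParityCheck H C ∧ ebits q H = c}

/-- The ratio factor `α^H_{n,k,ℓ,q}`, for `ℓ + 1 ≤ k ≤ n - ℓ - 1`. In this range none of the
natural-number subtractions truncates and the denominator is positive. -/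
noncomputable def alphaH (n k ℓ q : ℕ) : ℝ :=
  (q : ℝ) ^ (n - 2 * ℓ - 1) * ((q : ℝ) ^ (ℓ + 1) + 1) /
    (((q : ℝ) ^ (k - ℓ) - (-1) ^ (k - ℓ)) *
      ((q : ℝ) ^ (n - k - ℓ) - (-1) ^ (n - k - ℓ)))

end HermitianCode

/-!
The count `A_ℓ` of codes of dimension `k` with Hermitian hull of dimension `ℓ` is compared with
`A_{ℓ+1}` by double counting, without computing either. Let `B` be the number of codes `D` of
dimension `k - 1` with hull dimension `ℓ`, and consider the pairs `D < C` in which `C` has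
dimension `k` and hull dimension `ℓ`, respectively `ℓ + 1` (`numCodes_mul_eq`). The number of
extensions of a code by one dimension with a prescribed hull dimension depends only on the
dimensions of the code and its hull (`numExt_same`, `numExt_succ`, `numExt_pred`), and the number
of hyperplanes of `C` with a prescribed hull dimension is the number of such extensions of `C^⊥`,
because a code and its dual have the same hull (`natCard_hyperplanes`). This gives two relations
`A_ℓ u = B s` and `A_{ℓ+1} u' = B s'`, in which no factor vanishes, and eliminating `B` yields the
ratio (`numCodes_ratio`).

The extension numbers come from the behaviour of `D ⊔ ⟨v⟩`. If `v` is outside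
`D + D^⊥ = (hull D)^⊥`, then the hull loses a dimension. Otherwise `v` may be replaced by a vector
`w` of `D^⊥`, and the hull stays the same if `⟨w, w⟩ ≠ 0`, and is enlarged by `w` if `⟨w, w⟩ = 0`.
So what is needed is the number of isotropic vectors in a Hermitian space (`numIsotropic_eq`),
which is found by splitting off non-isotropic vectors one at a time.

For a parity check matrix `H` of `C`, the map `H†` is an isomorphism onto `C^⊥` which carries
the kernel of `H H†` to the hull of `C`; rank-nullity gives the number of ebits
(`ebits_add_finrank`). The bounds on the ratio factor are elementary. Strict monotonicity also
needs the counts to be nonzero, and this follows from the ratio decomposition, by which they are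
all zero or all nonzero (`numCodes_pos`).
-/

namespace HermitianCode

open Module

variable {K : Type*} [Field K] [Fintype K] {q n r : ℕ}

/-! ### The Hermitian form and the Hermitian dual -/

/-- The conjugation `x ↦ x ^ q` of a field with `q ^ 2` elements, as a ring homomorphism. -/
def conjHom {K : Type*} [Field K] [Fintype K] {q : ℕ} (hK : Fintype.card K = q ^ 2) :
    K →+* K where
  toFun x := x ^ q
  map_one' := one_pow q
  map_mul' x y := mul_pow x y q
  map_zero' := zero_pow (pos_of_card_eq_sq hK)
  map_add' := add_pow_of_card_eq_sq hK

@[simp]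
theorem conjHom_apply (hK : Fintype.card K = q ^ 2) (x : K) : conjHom hK x = x ^ q := rfl

theorem two_le_of_card_eq_sq (hK : Fintype.card K = q ^ 2) : 2 ≤ q := by
  have h := Fintype.one_lt_card (α := K)
  by_contra! h2
  interval_cases q <;> omega

theorem pow_pow_of_card_eq_sq (hK : Fintype.card K = q ^ 2) (x : K) : (x ^ q) ^ q = x := by
  rw [← pow_mul, ← sq, ← hK, FiniteField.pow_card]

omit [Fintype K] in
theorem hermInner_add_left (x y z : Fin n → K) :
    hermInner q (x + y) z = hermInner q x z + hermInner q y z := by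
  simp [hermInner, add_mul, Finset.sum_add_distrib]

omit [Fintype K] in
theorem hermInner_smul_left (c : K) (x y : Fin n → K) :
    hermInner q (c • x) y = c * hermInner q x y := by
  simp [hermInner, Finset.mul_sum, mul_assoc]

theorem hermInner_symm (hK : Fintype.card K = q ^ 2) (x y : Fin n → K) :
    hermInner q x y ^ q = hermInner q y x := by
  rw [← conjHom_apply hK, hermInner, map_sum]
  refine Finset.sum_congr rfl fun i _ => ?_
  rw [conjHom_apply, mul_pow, pow_pow_of_card_eq_sq hK, mul_comm]

theorem hermInner_add_right (hK : Fintype.card K = q ^ 2) (x y z : Fin n → K) :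
    hermInner q x (y + z) = hermInner q x y + hermInner q x z := by
  simp only [← hermInner_symm hK _ x, hermInner_add_left, add_pow_of_card_eq_sq hK]

omit [Fintype K] in
theorem hermInner_smul_right (c : K) (x y : Fin n → K) :
    hermInner q x (c • y) = c ^ q * hermInner q x y := by
  simp only [hermInner, Pi.smul_apply, smul_eq_mul, mul_pow, Finset.mul_sum]
  exact Finset.sum_congr rfl fun i _ => by ring

theorem hermInner_eq_zero_comm (hK : Fintype.card K = q ^ 2) {x y : Fin n → K} :
    hermInner q x y = 0 ↔ hermInner q y x = 0 := by
  rw [← hermInner_symm hK x y, pow_eq_zero_iff (pos_of_card_eq_sq hK)]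

theorem mem_hermDual (hK : Fintype.card K = q ^ 2) {C : Submodule K (Fin n → K)}
    {y : Fin n → K} : y ∈ hermDual hK C ↔ ∀ x ∈ C, hermInner q x y = 0 := Iff.rfl

theorem mem_hermDual_span_singleton (hK : Fintype.card K = q ^ 2) {x y : Fin n → K} :
    y ∈ hermDual hK (K ∙ x) ↔ hermInner q x y = 0 := by
  rw [mem_hermDual]
  refine ⟨fun h => h x (Submodule.mem_span_singleton_self x), fun h z hz => ?_⟩
  obtain ⟨c, rfl⟩ := Submodule.mem_span_singleton.1 hz
  rw [hermInner_smul_left, h, mul_zero]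

theorem natCard_submodule (hK : Fintype.card K = q ^ 2) (W : Submodule K (Fin n → K)) :
    Nat.card W = (q ^ 2) ^ finrank K W := by
  rw [natCard_eq_pow_finrank (K := K), Nat.card_eq_fintype_card, hK]

theorem sq_pow_injective (hK : Fintype.card K = q ^ 2) :
    Function.Injective fun d : ℕ => (q ^ 2) ^ d :=
  Nat.pow_right_injective (by nlinarith [two_le_of_card_eq_sq hK])

/-- Entrywise conjugation followed by the dot product identifies the Hermitian dual of `C` with
the annihilator of `C` as a set, so the two have the same cardinality, hence dimension. -/
theorem finrank_add_finrank_hermDual (hK : Fintype.card K = q ^ 2)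
    (C : Submodule K (Fin n → K)) : finrank K C + finrank K (hermDual hK C) = n := by
  let e : (Fin n → K) ≃ (Fin n → K) := Equiv.piCongrRight fun _ =>
    Equiv.ofBijective (conjHom hK) (Finite.injective_iff_bijective.1 (conjHom hK).injective)
  have hcard : Nat.card (hermDual hK C) = Nat.card C.dualAnnihilator := by
    refine Nat.card_congr ((e.trans (dotProductEquiv K (Fin n)).toEquiv).subtypeEquiv ?_)
    intro y
    have key : ∀ x : Fin n → K, dotProductEquiv K (Fin n) (e y) x = hermInner q x y := by
      intro x
      simp [dotProductEquiv, e, hermInner, dotProduct, mul_comm]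
    simp only [mem_hermDual, Submodule.mem_dualAnnihilator, Equiv.trans_apply,
      LinearEquiv.coe_toEquiv, key]
  have h := Subspace.finrank_add_finrank_dualAnnihilator_eq C
  rw [finrank_fin_fun] at h
  rw [natCard_submodule hK, natCard_eq_pow_finrank (K := K), Nat.card_eq_fintype_card, hK] at hcard
  rw [sq_pow_injective hK hcard, h]

theorem hermDual_hermDual (hK : Fintype.card K = q ^ 2) (C : Submodule K (Fin n → K)) :
    hermDual hK (hermDual hK C) = C := by
  symm
  apply Submodule.eq_of_le_of_finrank_eq
  · intro x hx y hy
    exact (hermInner_eq_zero_comm hK).1 (hy x hx)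
  · have h1 := finrank_add_finrank_hermDual hK C
    have h2 := finrank_add_finrank_hermDual hK (hermDual hK C)
    omega

theorem hermDual_anti (hK : Fintype.card K = q ^ 2) {C D : Submodule K (Fin n → K)}
    (h : C ≤ D) : hermDual hK D ≤ hermDual hK C :=
  fun _ hy x hx => hy x (h hx)

theorem hermDual_le_hermDual (hK : Fintype.card K = q ^ 2) {C D : Submodule K (Fin n → K)} :
    hermDual hK D ≤ hermDual hK C ↔ C ≤ D :=
  ⟨fun h => by simpa only [hermDual_hermDual] using hermDual_anti hK h, hermDual_anti hK⟩

theorem hermDual_sup (hK : Fintype.card K = q ^ 2) (C D : Submodule K (Fin n → K)) :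
    hermDual hK (C ⊔ D) = hermDual hK C ⊓ hermDual hK D := by
  refine le_antisymm (le_inf (hermDual_anti hK le_sup_left) (hermDual_anti hK le_sup_right)) ?_
  rintro y ⟨hC, hD⟩ x hx
  obtain ⟨c, hc, d, hd, rfl⟩ := Submodule.mem_sup.1 hx
  rw [hermInner_add_left, hC c hc, hD d hd, add_zero]

theorem hermDual_inf (hK : Fintype.card K = q ^ 2) (C D : Submodule K (Fin n → K)) :
    hermDual hK (C ⊓ D) = hermDual hK C ⊔ hermDual hK D := by
  rw [← hermDual_hermDual hK (hermDual hK C ⊔ hermDual hK D), hermDual_sup, hermDual_hermDual,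
    hermDual_hermDual]

theorem hermHull_hermDual (hK : Fintype.card K = q ^ 2) (C : Submodule K (Fin n → K)) :
    hermHull hK (hermDual hK C) = hermHull hK C := by
  rw [hermHull, hermHull, hermDual_hermDual, inf_comm]

theorem hermDual_hermHull (hK : Fintype.card K = q ^ 2) (C : Submodule K (Fin n → K)) :
    hermDual hK (hermHull hK C) = C ⊔ hermDual hK C := by
  rw [hermHull, hermDual_inf, hermDual_hermDual, sup_comm]

/-! ### Isotropic vectors -/

/-- The norm `c ↦ c ^ (q + 1)` onto the nonzero elements of the subfield of `q` elements is
`(q + 1)`-to-one. -/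
theorem natCard_norm_eq (hK : Fintype.card K = q ^ 2) {t : K} (ht : t ^ q = t) (ht0 : t ≠ 0) :
    Nat.card {c : K // c ^ (q + 1) = t} = q + 1 := by
  classical
  have hq := two_le_of_card_eq_sq hK
  have hcard : Nat.card Kˣ = (q - 1) * (q + 1) := by
    rw [Nat.card_units, Nat.card_eq_fintype_card, hK]
    obtain ⟨m, rfl⟩ := Nat.exists_eq_add_of_le hq
    rw [Nat.sub_eq_iff_eq_add (by nlinarith), show 2 + m - 1 = m + 1 by omega]
    ring
  -- the `(q + 1)`-st powers and the `(q - 1)`-st roots of unity are both `q - 1` in number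
  have hrange : (powMonoidHom (q + 1) : Kˣ →* Kˣ).range =
      (powMonoidHom (q - 1) : Kˣ →* Kˣ).ker := by
    apply Subgroup.eq_of_le_of_card_ge
    · rintro _ ⟨u, rfl⟩
      rw [MonoidHom.mem_ker, powMonoidHom_apply, powMonoidHom_apply, ← pow_mul,
        mul_comm, ← hcard, pow_card_eq_one']
    · rw [IsCyclic.card_powMonoidHom_range, IsCyclic.card_powMonoidHom_ker, hcard,
        Nat.gcd_mul_left_left, Nat.gcd_mul_right_left, Nat.mul_div_cancel _ (by omega)]
  have hmem : Units.mk0 t ht0 ∈ (powMonoidHom (q + 1) : Kˣ →* Kˣ).range := by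
    rw [hrange, MonoidHom.mem_ker, powMonoidHom_apply, Units.ext_iff]
    have h1 : t * t ^ (q - 1) = t * 1 := by
      rw [← pow_succ', mul_one, show q - 1 + 1 = q by omega, ht]
    simpa using mul_left_cancel₀ ht0 h1
  obtain ⟨u, hu⟩ := hmem
  have hu' : (u : K) ^ (q + 1) = t := by simpa using congrArg Units.val hu
  calc Nat.card {c : K // c ^ (q + 1) = t}
      = Nat.card (powMonoidHom (q + 1) : Kˣ →* Kˣ).ker := by
        symm
        refine Nat.card_congr (Equiv.ofBijective
          (fun v => ⟨(u : K) * ((v : Kˣ) : K), ?_⟩) ⟨?_, ?_⟩)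
        · have hv : ((v : Kˣ) : K) ^ (q + 1) = 1 := by
            have hv := MonoidHom.mem_ker.1 v.2
            rw [powMonoidHom_apply] at hv
            rw [← Units.val_pow_eq_pow_val, hv, Units.val_one]
          rw [mul_pow, hu', hv, mul_one]
        · intro v w h
          exact Subtype.ext (Units.ext (mul_left_cancel₀ u.ne_zero (congrArg Subtype.val h)))
        · rintro ⟨c, hc⟩
          have hc0 : c ≠ 0 := by
            rintro rfl
            exact ht0 (by rw [← hc, zero_pow (by omega)])
          refine ⟨⟨u⁻¹ * Units.mk0 c hc0, ?_⟩, ?_⟩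
          · rw [MonoidHom.mem_ker, powMonoidHom_apply, Units.ext_iff]
            simp [mul_pow, hu', hc, ht0]
          · simp
    _ = q + 1 := by
        rw [IsCyclic.card_powMonoidHom_ker, hcard, Nat.gcd_mul_left_left]

/-- The trace `d ↦ d ^ q + d` is not identically zero. -/
theorem exists_pow_ne_neg (hK : Fintype.card K = q ^ 2) : ∃ d : K, d ^ q ≠ -d := by
  by_contra! h
  have hq := two_le_of_card_eq_sq hK
  have h1 : (1 : K) = -1 := by simpa using h 1
  have h2 : ∀ d : K, d ^ q = d := fun d => by rw [h d, ← mul_one d, ← mul_neg, ← h1]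
  obtain ⟨g, hg⟩ := IsCyclic.exists_generator (α := Kˣ)
  have h3 : g ^ (q - 1) = 1 := by
    have : (g : K) * (g : K) ^ (q - 1) = g * 1 := by
      rw [← pow_succ', mul_one, show q - 1 + 1 = q by omega, h2]
    simpa [Units.ext_iff] using mul_left_cancel₀ g.ne_zero this
  have h4 := Nat.le_of_dvd (by omega) (orderOf_dvd_of_pow_eq_one h3)
  rw [orderOf_eq_card_of_forall_mem_zpowers hg, Nat.card_units, Nat.card_eq_fintype_card, hK] at h4
  have : 2 * q ≤ q ^ 2 := by nlinarith
  omega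

/-- Polarization: a subspace all of whose vectors are isotropic is totally isotropic. -/
theorem exists_hermInner_self_ne_zero (hK : Fintype.card K = q ^ 2) {W : Submodule K (Fin n → K)}
    (hW : ¬ W ≤ hermDual hK W) : ∃ x ∈ W, hermInner q x x ≠ 0 := by
  by_contra! h
  refine hW fun y hy x hx => ?_
  by_contra hs
  obtain ⟨d, hd⟩ := exists_pow_ne_neg hK
  have hs' : hermInner q y x ≠ 0 := fun h0 => hs ((hermInner_eq_zero_comm hK).1 h0)
  -- with this scalar the cross terms of `⟨x + c y, x + c y⟩` become `d ^ q + d`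
  set c : K := d / hermInner q y x with hc
  have key := h (x + c • y) (W.add_mem hx (W.smul_mem c hy))
  rw [hermInner_add_left, hermInner_add_right hK, hermInner_add_right hK, h x hx,
    hermInner_smul_right, hermInner_smul_left, hermInner_smul_left, hermInner_smul_right,
    h y hy, ← hermInner_symm hK y x, ← mul_pow, hc, div_mul_cancel₀ _ hs'] at key
  apply hd
  linear_combination key

theorem exists_eq_smul_add (hK : Fintype.card K = q ^ 2) {W : Submodule K (Fin n → K)}
    {x : Fin n → K} (hx : x ∈ W) (hxx : hermInner q x x ≠ 0) {z : Fin n → K} (hz : z ∈ W) :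
    ∃ c : K, ∃ y ∈ W ⊓ hermDual hK (K ∙ x), z = c • x + y := by
  refine ⟨hermInner q z x / hermInner q x x, z - (hermInner q z x / hermInner q x x) • x,
    ⟨W.sub_mem hz (W.smul_mem _ hx), ?_⟩, by simp⟩
  rw [SetLike.mem_coe, mem_hermDual_span_singleton, hermInner_eq_zero_comm hK, sub_eq_add_neg,
    ← neg_smul, hermInner_add_left, hermInner_smul_left, neg_mul, div_mul_cancel₀ _ hxx,
    add_neg_cancel]

/-- Splitting off a non-isotropic vector does not change the hull. -/
theorem hermHull_inf_hermDual_span (hK : Fintype.card K = q ^ 2) {W : Submodule K (Fin n → K)}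
    {x : Fin n → K} (hx : x ∈ W) (hxx : hermInner q x x ≠ 0) :
    hermHull hK (W ⊓ hermDual hK (K ∙ x)) = hermHull hK W := by
  apply le_antisymm
  · rintro z ⟨⟨hzW, hzx⟩, hz⟩
    refine ⟨hzW, fun w hw => ?_⟩
    obtain ⟨c, y, hy, rfl⟩ := exists_eq_smul_add hK hx hxx hw
    rw [hermInner_add_left, hermInner_smul_left, (mem_hermDual_span_singleton hK).1 hzx,
      hz y hy, mul_zero, add_zero]
  · rintro z ⟨hzW, hz⟩
    exact ⟨⟨hzW, (mem_hermDual_span_singleton hK).2 (hz x hx)⟩, hermDual_anti hK inf_le_left hz⟩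

theorem finrank_inf_hermDual_span (hK : Fintype.card K = q ^ 2) {W : Submodule K (Fin n → K)}
    {x : Fin n → K} (hx : x ∈ W) (hxx : hermInner q x x ≠ 0) :
    finrank K W = finrank K (W ⊓ hermDual hK (K ∙ x) : Submodule K (Fin n → K)) + 1 := by
  have hxW : x ∉ W ⊓ hermDual hK (K ∙ x) := fun h =>
    hxx ((mem_hermDual_span_singleton hK).1 (Submodule.mem_inf.1 h).2)
  have : W ⊓ hermDual hK (K ∙ x) ⊔ K ∙ x = W := by
    refine le_antisymm (sup_le inf_le_left ((Submodule.span_singleton_le_iff_mem _ _).2 hx)) ?_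
    intro z hz
    obtain ⟨c, y, hy, rfl⟩ := exists_eq_smul_add hK hx hxx hz
    exact add_mem (Submodule.mem_sup_right (Submodule.smul_mem _ _
      (Submodule.mem_span_singleton_self x))) (Submodule.mem_sup_left hy)
  rw [← Submodule.finrank_sup_span_singleton hxW, this]

theorem hermInner_smul_add_self (hK : Fintype.card K = q ^ 2) {x y : Fin n → K}
    (hxy : hermInner q x y = 0) (c : K) :
    hermInner q (c • x + y) (c • x + y) = c ^ (q + 1) * hermInner q x x + hermInner q y y := by
  simp only [hermInner_add_left, hermInner_add_right hK, hermInner_smul_left,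
    hermInner_smul_right, hxy, (hermInner_eq_zero_comm hK).1 hxy]
  ring

/-- The number of isotropic vectors of `W`, the zero vector included. -/
noncomputable def numIsotropic (q : ℕ) (W : Submodule K (Fin n → K)) : ℕ :=
  Nat.card {w : W // hermInner q (w : Fin n → K) w = 0}

/-- For `W = ⟨x⟩ ⊕ W'` orthogonally, each isotropic `y ∈ W'` extends to the single isotropic
vector `y` of `W`, and each other `y ∈ W'` to the `q + 1` vectors `c x + y` for which
`c ^ (q + 1) = - ⟨y, y⟩ / ⟨x, x⟩`. -/
theorem numIsotropic_recursion (hK : Fintype.card K = q ^ 2) {W : Submodule K (Fin n → K)}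
    {x : Fin n → K} (hx : x ∈ W) (hxx : hermInner q x x ≠ 0) :
    (numIsotropic q W : ℤ) = (q + 1) * (q ^ 2) ^ finrank K (W ⊓ hermDual hK (K ∙ x) :
        Submodule K (Fin n → K)) - q * numIsotropic q (W ⊓ hermDual hK (K ∙ x)) := by
  classical
  set W' : Submodule K (Fin n → K) := W ⊓ hermDual hK (K ∙ x)
  have horth : ∀ y ∈ W', hermInner q x y = 0 := fun y hy =>
    (mem_hermDual_span_singleton hK).1 hy.2
  have hfib : numIsotropic q W = Nat.card (Σ y : W',
      {c : K // c ^ (q + 1) = -hermInner q (y : Fin n → K) y / hermInner q x x}) := by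
    symm
    have hiff : ∀ (y : W') (c : K), c ^ (q + 1) = -hermInner q (y : Fin n → K) y / hermInner q x x ↔
        hermInner q (c • x + (y : Fin n → K)) (c • x + y) = 0 := fun y c => by
      rw [hermInner_smul_add_self hK (horth y y.2), eq_div_iff hxx, eq_neg_iff_add_eq_zero]
    refine Nat.card_congr (Equiv.ofBijective (fun p => ⟨⟨p.2.1 • x + (p.1 : Fin n → K),
      W.add_mem (W.smul_mem _ hx) p.1.2.1⟩, (hiff _ _).1 p.2.2⟩) ⟨?_, ?_⟩)
    · rintro ⟨y, c, hc⟩ ⟨y', c', hc'⟩ h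
      simp only [Subtype.mk.injEq] at h
      have h1 := congrArg (hermInner q · x) h
      simp only [hermInner_add_left, hermInner_smul_left,
        (hermInner_eq_zero_comm hK).1 (horth _ y.2),
        (hermInner_eq_zero_comm hK).1 (horth _ y'.2), add_zero] at h1
      obtain rfl := mul_right_cancel₀ hxx h1
      obtain rfl : y = y' := Subtype.ext (add_left_cancel h)
      rfl
    · rintro ⟨⟨z, hz⟩, hzz⟩
      obtain ⟨c, y, hy, rfl⟩ := exists_eq_smul_add hK hx hxx hz
      exact ⟨⟨⟨y, hy⟩, c, (hiff ⟨y, hy⟩ c).2 hzz⟩, rfl⟩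
  have hcount : ∀ y : W', (Nat.card
      {c : K // c ^ (q + 1) = -hermInner q (y : Fin n → K) y / hermInner q x x} : ℤ) =
      (q + 1) - if hermInner q (y : Fin n → K) y = 0 then (q : ℤ) else 0 := by
    intro y
    split_ifs with h
    · rw [h, neg_zero, zero_div]
      simp
    · rw [natCard_norm_eq hK]
      · simp
      · rw [← conjHom_apply hK, map_div₀, map_neg, conjHom_apply, conjHom_apply,
          hermInner_symm hK, hermInner_symm hK]
      · exact div_ne_zero (neg_ne_zero.2 h) hxx
  rw [hfib, Nat.card_sigma, Nat.cast_sum, Finset.sum_congr rfl fun y _ => hcount y,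
    Finset.sum_sub_distrib, ← Finset.sum_filter, Finset.sum_const, Finset.sum_const, Finset.card_univ,
    ← Nat.card_eq_fintype_card, natCard_submodule hK, numIsotropic, Nat.card_eq_fintype_card,
    Fintype.card_subtype]
  simp only [nsmul_eq_mul]
  push_cast
  ring

/-- The number of isotropic vectors of a Hermitian space with radical of dimension `r` and
nondegenerate quotient of dimension `b`, by induction on `b`. The factor `q` keeps the formula
integral for `b = 0`, where every vector is isotropic. -/
theorem numIsotropic_eq (hK : Fintype.card K = q ^ 2) {r b : ℕ} {W : Submodule K (Fin n → K)}
    (hW : finrank K W = r + b) (hr : finrank K (hermHull hK W) = r) :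
    (q : ℤ) * numIsotropic q W =
      (q ^ 2) ^ r * (q ^ (2 * b) + (-1) ^ b * (q ^ (b + 1) - q ^ b)) := by
  induction b generalizing W with
  | zero =>
    have hWW : W ≤ hermDual hK W := by
      have h : hermHull hK W = W :=
        Submodule.eq_of_le_of_finrank_eq inf_le_left (by rw [hr, hW, add_zero])
      exact inf_eq_left.1 h
    have h0 : numIsotropic q W = Nat.card W :=
      Nat.card_congr (Equiv.subtypeUnivEquiv fun w => hWW w.2 w w.2)
    rw [h0, natCard_submodule hK, hW]
    push_cast
    ring
  | succ b ih =>
    have hWW : ¬ W ≤ hermDual hK W := by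
      intro h
      rw [hermHull, inf_eq_left.2 h] at hr
      omega
    obtain ⟨x, hx, hxx⟩ := exists_hermInner_self_ne_zero hK hWW
    have hdim := finrank_inf_hermDual_span hK hx hxx
    have hdim' : finrank K (W ⊓ hermDual hK (K ∙ x) : Submodule K (Fin n → K)) = r + b := by
      omega
    have h := ih hdim' (by rw [hermHull_inf_hermDual_span hK hx hxx, hr])
    rw [numIsotropic_recursion hK hx hxx, hdim', mul_sub, mul_left_comm (q : ℤ) q, h]
    ring

/-! ### One-dimensional extensions of a code -/

theorem natCard_add_natCard_of_iff {α : Type*} [Finite α] {P Q R : α → Prop}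
    (h : ∀ x, R x ↔ P x ∨ Q x) (hPQ : ∀ x, P x → ¬ Q x) :
    Nat.card {x // P x} + Nat.card {x // Q x} = Nat.card {x // R x} := by
  have hdisj : Disjoint {x | P x} {x | Q x} := Set.disjoint_left.2 hPQ
  have hunion : {x | R x} = {x | P x} ∪ {x | Q x} := Set.ext h
  have := Set.ncard_union_eq hdisj
  rw [← hunion] at this
  exact this.symm

omit [Fintype K] in
theorem sup_span_add_of_mem {D : Submodule K (Fin n → K)} {d : Fin n → K} (hd : d ∈ D)
    (w : Fin n → K) : D ⊔ K ∙ (d + w) = D ⊔ K ∙ w := by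
  apply le_antisymm <;> refine sup_le le_sup_left ((Submodule.span_singleton_le_iff_mem _ _).2 ?_)
  · exact add_mem (Submodule.mem_sup_left hd)
      (Submodule.mem_sup_right (Submodule.mem_span_singleton_self w))
  · have h := sub_mem (Submodule.mem_sup_right (S := D)
      (Submodule.mem_span_singleton_self (R := K) (d + w))) (Submodule.mem_sup_left hd)
    rwa [add_sub_cancel_left] at h

omit [Fintype K] in
theorem mem_sup_span_singleton {D : Submodule K (Fin n → K)} {v z : Fin n → K} :
    z ∈ D ⊔ K ∙ v ↔ ∃ d ∈ D, ∃ c : K, d + c • v = z := by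
  simp only [Submodule.mem_sup, Submodule.mem_span_singleton, exists_exists_eq_and]

theorem hermHull_sup_span_of_not_isotropic (hK : Fintype.card K = q ^ 2)
    {D : Submodule K (Fin n → K)} {w : Fin n → K} (hw : w ∈ hermDual hK D)
    (hww : hermInner q w w ≠ 0) : hermHull hK (D ⊔ K ∙ w) = hermHull hK D := by
  rw [← hermHull_inf_hermDual_span hK (x := w) (W := D ⊔ K ∙ w)
    (Submodule.mem_sup_right (Submodule.mem_span_singleton_self w)) hww]
  congr 1
  apply le_antisymm
  · rintro z ⟨hz, hzw⟩
    obtain ⟨d, hd, c, rfl⟩ := mem_sup_span_singleton.1 hz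
    have h := (mem_hermDual_span_singleton hK).1 hzw
    rw [hermInner_add_right hK, hermInner_smul_right, (hermInner_eq_zero_comm hK).1 (hw d hd),
      zero_add, mul_eq_zero, or_iff_left hww, pow_eq_zero_iff (pos_of_card_eq_sq hK)] at h
    rwa [h, zero_smul, add_zero]
  · exact fun d hd => ⟨Submodule.mem_sup_left hd,
      (mem_hermDual_span_singleton hK).2 ((hermInner_eq_zero_comm hK).1 (hw d hd))⟩

theorem hermHull_sup_span_of_isotropic (hK : Fintype.card K = q ^ 2)
    {D : Submodule K (Fin n → K)} {w : Fin n → K} (hw : w ∈ hermDual hK D)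
    (hww : hermInner q w w = 0) : hermHull hK (D ⊔ K ∙ w) = hermHull hK D ⊔ K ∙ w := by
  have hw' : w ∈ hermDual hK (K ∙ w) := (mem_hermDual_span_singleton hK).2 hww
  rw [hermHull, hermDual_sup]
  apply le_antisymm
  · rintro z ⟨hz, hzD, -⟩
    obtain ⟨d, hd, c, rfl⟩ := mem_sup_span_singleton.1 hz
    refine mem_sup_span_singleton.2 ⟨d, ⟨hd, ?_⟩, c, rfl⟩
    have h := (hermDual hK D).sub_mem hzD ((hermDual hK D).smul_mem c hw)
    rwa [add_sub_cancel_right] at h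
  · refine sup_le ?_ ((Submodule.span_singleton_le_iff_mem _ _).2
      ⟨Submodule.mem_sup_right (Submodule.mem_span_singleton_self w), hw, hw'⟩)
    exact fun d hd => ⟨Submodule.mem_sup_left hd.1, hd.2,
      (mem_hermDual_span_singleton hK).2 ((hermInner_eq_zero_comm hK).1 (hw d hd.1))⟩

theorem hermHull_sup_span_of_notMem (hK : Fintype.card K = q ^ 2)
    {D : Submodule K (Fin n → K)} {v : Fin n → K} (hv : v ∉ hermDual hK (hermHull hK D)) :
    hermHull hK (D ⊔ K ∙ v) = hermHull hK D ⊓ hermDual hK (K ∙ v) := by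
  rw [hermHull, hermDual_sup]
  apply le_antisymm
  · rintro z ⟨hz, hzD, hzv⟩
    refine ⟨⟨?_, hzD⟩, hzv⟩
    obtain ⟨d, hd, c, rfl⟩ := mem_sup_span_singleton.1 hz
    have hc : c = 0 := by
      rw [mem_hermDual] at hv
      push Not at hv
      obtain ⟨r, hr, hrv⟩ := hv
      have h := hzD r hr.1
      rw [hermInner_add_right hK, hermInner_smul_right,
        (hermInner_eq_zero_comm hK).1 (hr.2 d hd), zero_add, mul_eq_zero, or_iff_left hrv,
        pow_eq_zero_iff (pos_of_card_eq_sq hK)] at h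
      exact h
    rwa [hc, zero_smul, add_zero]
  · rintro z ⟨⟨hz, hzD⟩, hzv⟩
    exact ⟨Submodule.mem_sup_left hz, hzD, hzv⟩

theorem finrank_inf_hermDual_span_of_notMem (hK : Fintype.card K = q ^ 2)
    {R : Submodule K (Fin n → K)} {v : Fin n → K} (hv : v ∉ hermDual hK R) :
    finrank K (R ⊓ hermDual hK (K ∙ v) : Submodule K (Fin n → K)) + 1 = finrank K R := by
  have hsum := finrank_add_finrank_hermDual hK (hermDual hK R ⊔ K ∙ v)
  rw [hermDual_sup, hermDual_hermDual, Submodule.finrank_sup_span_singleton hv] at hsum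
  have := finrank_add_finrank_hermDual hK R
  omega

/-- The number of codes `C ⊇ D` of dimension `dim D + 1` with hull of dimension `j`. -/
noncomputable def numExt (hK : Fintype.card K = q ^ 2) (D : Submodule K (Fin n → K)) (j : ℕ) : ℕ :=
  Nat.card {C : Submodule K (Fin n → K) //
    D ≤ C ∧ finrank K C = finrank K D + 1 ∧ finrank K (hermHull hK C) = j}

/-- Vectors `v` outside `D` such that `D ⊔ ⟨v⟩` has a hull of dimension `j`. -/
def IsExtVector (hK : Fintype.card K = q ^ 2) (D : Submodule K (Fin n → K)) (j : ℕ)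
    (v : Fin n → K) : Prop :=
  v ∉ D ∧ finrank K (hermHull hK (D ⊔ K ∙ v)) = j

theorem isExtVector_add_iff (hK : Fintype.card K = q ^ 2) {D : Submodule K (Fin n → K)} {j : ℕ}
    {d : Fin n → K} (hd : d ∈ D) (w : Fin n → K) :
    IsExtVector hK D j (d + w) ↔ IsExtVector hK D j w := by
  rw [IsExtVector, IsExtVector, sup_span_add_of_mem hd, Submodule.add_mem_iff_right D hd]

/-- Each extension `C` of `D` is `D ⊔ ⟨v⟩` for exactly the `v ∈ C \ D`. -/
theorem natCard_isExtVector (hK : Fintype.card K = q ^ 2) (D : Submodule K (Fin n → K)) (j : ℕ) :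
    (Nat.card {v // IsExtVector hK D j v} : ℤ) =
      numExt hK D j * ((q ^ 2 - 1) * (q ^ 2) ^ finrank K D) := by
  classical
  have hC : ∀ {C : Submodule K (Fin n → K)} {v : Fin n → K}, D ≤ C →
      finrank K C = finrank K D + 1 → v ∈ C → v ∉ D → D ⊔ K ∙ v = C := by
    intro C v hDC hdim hv hvD
    exact Submodule.eq_of_le_of_finrank_eq
      (sup_le hDC ((Submodule.span_singleton_le_iff_mem _ _).2 hv))
      (by rw [Submodule.finrank_sup_span_singleton hvD, hdim])
  have hsigma : Nat.card {v // IsExtVector hK D j v} =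
      Nat.card (Σ C : {C : Submodule K (Fin n → K) //
        D ≤ C ∧ finrank K C = finrank K D + 1 ∧ finrank K (hermHull hK C) = j},
        {v // v ∈ C.1 ∧ v ∉ D}) := by
    symm
    refine Nat.card_congr (Equiv.ofBijective (fun p => ⟨p.2.1, p.2.2.2, ?_⟩) ⟨?_, ?_⟩)
    · rw [hC p.1.2.1 p.1.2.2.1 p.2.2.1 p.2.2.2, p.1.2.2.2]
    · rintro ⟨⟨C, h1, h2, h3⟩, v, hv, hvD⟩ ⟨⟨C', h1', h2', h3'⟩, v', hv', hvD'⟩ h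
      obtain rfl : v = v' := congrArg Subtype.val h
      obtain rfl : C = C' := by rw [← hC h1 h2 hv hvD, ← hC h1' h2' hv' hvD']
      rfl
    · rintro ⟨v, hv, hj⟩
      exact ⟨⟨⟨D ⊔ K ∙ v, le_sup_left, Submodule.finrank_sup_span_singleton hv, hj⟩, v,
        Submodule.mem_sup_right (Submodule.mem_span_singleton_self v), hv⟩, rfl⟩
  have : Fintype (Submodule K (Fin n → K)) := Fintype.ofFinite _
  rw [hsigma, Nat.card_sigma, Nat.cast_sum, numExt, Nat.card_eq_fintype_card,
    Finset.sum_congr rfl (g := fun _ => ((q : ℤ) ^ 2 - 1) * (q ^ 2) ^ finrank K D)]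
  · rw [Finset.sum_const, nsmul_eq_mul, Finset.card_univ]
  · rintro ⟨C, h1, h2, h3⟩ -
    have hdiff : Nat.card {v // v ∈ C ∧ v ∉ D} + Nat.card D = Nat.card C := 
      natCard_add_natCard_of_iff (Q := (· ∈ D)) (R := (· ∈ C))
        (fun v => ⟨fun hv => or_iff_not_imp_right.2 fun h => ⟨hv, h⟩, Or.rec And.left fun h => h1 h⟩)
        fun _ h => h.2
    rw [natCard_submodule hK, natCard_submodule hK, h2] at hdiff
    zify at hdiff
    rw [eq_sub_of_add_eq hdiff]
    ring

/-- `D ⊕ D^⊥ → D + D^⊥` is `|D ∩ D^⊥|`-to-one. -/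
theorem natCard_hull_mul_natCard (hK : Fintype.card K = q ^ 2) (D : Submodule K (Fin n → K))
    {P : (Fin n → K) → Prop} (hP : ∀ d ∈ D, ∀ w, P (d + w) ↔ P w) :
    Nat.card (hermHull hK D) * Nat.card {v // v ∈ D ⊔ hermDual hK D ∧ P v} =
      Nat.card D * Nat.card {w // w ∈ hermDual hK D ∧ P w} := by
  have hex : ∀ v : {v // v ∈ D ⊔ hermDual hK D ∧ P v}, ∃ d ∈ D, v.1 - d ∈ hermDual hK D := by
    rintro ⟨v, hv, -⟩
    obtain ⟨d, hd, w, hw, rfl⟩ := Submodule.mem_sup.1 hv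
    exact ⟨d, hd, by rwa [add_sub_cancel_left]⟩
  choose f hf hf' using hex
  rw [← Nat.card_prod, ← Nat.card_prod]
  refine Nat.card_congr (Equiv.ofBijective (fun p => (⟨f p.2 + p.1, D.add_mem (hf _) p.1.2.1⟩,
    ⟨p.2.1 - (f p.2 + p.1), ?_, ?_⟩)) ⟨?_, ?_⟩)
  · rw [← sub_sub]
    exact sub_mem (hf' _) p.1.2.2
  · rw [← hP _ (D.add_mem (hf p.2) p.1.2.1), add_sub_cancel]
    exact p.2.2.2
  · rintro ⟨r, v⟩ ⟨r', v'⟩ h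
    simp only [Prod.mk.injEq, Subtype.mk.injEq] at h
    obtain ⟨h1, h2⟩ := h
    rw [h1, sub_left_inj] at h2
    obtain rfl := Subtype.ext h2
    rw [Subtype.ext (add_left_cancel h1)]
  · rintro ⟨⟨d, hd⟩, w, hw, hPw⟩
    let v : {v // v ∈ D ⊔ hermDual hK D ∧ P v} :=
      ⟨d + w, Submodule.add_mem_sup hd hw, (hP d hd w).2 hPw⟩
    have hv : v.1 = d + w := rfl
    have hr : d - f v ∈ hermDual hK D := by
      have h := sub_mem (hf' v) hw
      rwa [hv, show d + w - f v - w = d - f v by abel] at h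
    refine ⟨(⟨d - f v, D.sub_mem hd (hf v), hr⟩, v), ?_⟩
    simp [hv]

variable {D : Submodule K (Fin n → K)} {d ℓ b : ℕ}

theorem mem_sup_hermDual_of_isExtVector (hK : Fintype.card K = q ^ 2) {j : ℕ} {v : Fin n → K}
    (hj : finrank K (hermHull hK D) ≤ j) (h : IsExtVector hK D j v) :
    v ∈ D ⊔ hermDual hK D := by
  by_contra hv
  rw [← hermDual_hermHull] at hv
  have h1 := finrank_inf_hermDual_span_of_notMem hK hv
  rw [← hermHull_sup_span_of_notMem hK hv, h.2] at h1
  omega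

theorem isExtVector_iff (hK : Fintype.card K = q ^ 2) {w : Fin n → K} (hw : w ∈ hermDual hK D) :
    IsExtVector hK D (finrank K (hermHull hK D)) w ↔ hermInner q w w ≠ 0 := by
  constructor
  · rintro ⟨hwD, h⟩ hww
    rw [hermHull_sup_span_of_isotropic hK hw hww,
      Submodule.finrank_sup_span_singleton fun hw' : w ∈ hermHull hK D => hwD hw'.1] at h
    omega
  · exact fun hww => ⟨fun hwD => hww (hw w hwD), by rw [hermHull_sup_span_of_not_isotropic hK hw hww]⟩

theorem isExtVector_succ_iff (hK : Fintype.card K = q ^ 2) {w : Fin n → K}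
    (hw : w ∈ hermDual hK D) : IsExtVector hK D (finrank K (hermHull hK D) + 1) w ↔
      hermInner q w w = 0 ∧ w ∉ hermHull hK D := by
  constructor
  · rintro ⟨hwD, h⟩
    refine ⟨?_, fun h => hwD h.1⟩
    by_contra hww
    rw [hermHull_sup_span_of_not_isotropic hK hw hww] at h
    omega
  · rintro ⟨hww, hwD⟩
    refine ⟨fun h => hwD ⟨h, hw⟩, ?_⟩
    rw [hermHull_sup_span_of_isotropic hK hw hww, Submodule.finrank_sup_span_singleton hwD]

theorem natCard_hull_mul_natCard_isExtVector (hK : Fintype.card K = q ^ 2) {j : ℕ}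
    (hj : finrank K (hermHull hK D) ≤ j) :
    Nat.card (hermHull hK D) * Nat.card {v // IsExtVector hK D j v} =
      Nat.card D * Nat.card {w // w ∈ hermDual hK D ∧ IsExtVector hK D j w} := by
  rw [← natCard_hull_mul_natCard hK D fun d hd w => isExtVector_add_iff hK hd w]
  congr 1
  exact Nat.card_congr (Equiv.subtypeEquivRight fun v =>
    ⟨fun h => ⟨mem_sup_hermDual_of_isExtVector hK hj h, h⟩, And.right⟩)

theorem natCard_mem_hermDual_isotropic (hK : Fintype.card K = q ^ 2) :
    Nat.card {w // w ∈ hermDual hK D ∧ hermInner q w w = 0} =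
      numIsotropic q (hermDual hK D) :=
  (Nat.card_congr (Equiv.subtypeSubtypeEquivSubtypeInter (· ∈ hermDual hK D)
    fun w => hermInner q w w = 0)).symm

/-- The number of extensions that preserve the dimension of the hull: they are spanned over `D` by
the non-isotropic vectors of `D^⊥`. Here `b` is the dimension of `D^⊥` modulo the hull. -/
theorem numExt_same (hK : Fintype.card K = q ^ 2) (hℓ : finrank K (hermHull hK D) = ℓ)
    (hn : finrank K D + ℓ + b = n) :
    (q : ℤ) * (q + 1) * numExt hK D ℓ = q ^ b * (q ^ b - (-1) ^ b) := by
  have hq := two_le_of_card_eq_sq hK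
  have hdual := finrank_add_finrank_hermDual hK D
  have hN := numIsotropic_eq hK (b := b) (W := hermDual hK D) (r := ℓ) (by omega)
    (by rw [hermHull_hermDual, hℓ])
  have hsplit : Nat.card {w // w ∈ hermDual hK D ∧ IsExtVector hK D ℓ w} +
      numIsotropic q (hermDual hK D) = Nat.card (hermDual hK D) := by
    rw [← natCard_mem_hermDual_isotropic hK]
    refine natCard_add_natCard_of_iff (R := (· ∈ hermDual hK D)) (fun w => ?_) ?_
    · rw [← and_or_left, iff_self_and]
      intro hw
      rw [← hℓ, isExtVector_iff hK hw]
      exact em' _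
    · rintro w ⟨hw, h⟩
      rw [← hℓ, isExtVector_iff hK hw] at h
      exact fun h' => h h'.2
  have h1 := natCard_hull_mul_natCard_isExtVector hK hℓ.le
  have h2 := natCard_isExtVector hK D ℓ
  rw [natCard_submodule hK, natCard_submodule hK, hℓ] at h1
  rw [natCard_submodule hK, show finrank K (hermDual hK D) = ℓ + b by omega] at hsplit
  zify at h1 hsplit
  rw [h2, eq_sub_of_add_eq hsplit] at h1
  have hq0 : (q : ℤ) ≠ 0 := by positivity
  have hq1 : (q : ℤ) - 1 ≠ 0 := by
    have : (2 : ℤ) ≤ q := by exact_mod_cast hq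
    omega
  apply mul_left_cancel₀ (pow_ne_zero (finrank K D) (pow_ne_zero 2 hq0))
  apply mul_left_cancel₀ (pow_ne_zero ℓ (pow_ne_zero 2 hq0))
  apply mul_left_cancel₀ hq1
  linear_combination (q : ℤ) * h1 - ((q : ℤ) ^ 2) ^ finrank K D * hN

/-- The number of extensions that enlarge the hull: they are spanned over `D` by the isotropic
vectors of `D^⊥` outside the hull. -/
theorem numExt_succ (hK : Fintype.card K = q ^ 2) (hℓ : finrank K (hermHull hK D) = ℓ)
    (hn : finrank K D + ℓ + b = n) :
    (q : ℤ) * (q ^ 2 - 1) * numExt hK D (ℓ + 1) =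
      (q ^ b - (-1) ^ b) * (q ^ b + q * (-1) ^ b) := by
  have hq := two_le_of_card_eq_sq hK
  have hdual := finrank_add_finrank_hermDual hK D
  have hN := numIsotropic_eq hK (b := b) (W := hermDual hK D) (r := ℓ) (by omega)
    (by rw [hermHull_hermDual, hℓ])
  have hsplit : Nat.card {w // w ∈ hermDual hK D ∧ IsExtVector hK D (ℓ + 1) w} +
      Nat.card (hermHull hK D) = numIsotropic q (hermDual hK D) := by
    rw [← natCard_mem_hermDual_isotropic hK]
    refine natCard_add_natCard_of_iff (Q := (· ∈ hermHull hK D)) (fun w => ?_) ?_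
    · constructor
      · rintro ⟨hw, hww⟩
        refine or_iff_not_imp_right.2 fun h => ⟨hw, ?_⟩
        rw [← hℓ, isExtVector_succ_iff hK hw]
        exact ⟨hww, h⟩
      · rintro (⟨hw, h⟩ | h)
        · rw [← hℓ, isExtVector_succ_iff hK hw] at h
          exact ⟨hw, h.1⟩
        · exact ⟨h.2, h.2 w h.1⟩
    · exact fun w h h' => h.2.1 h'.1
  have h1 := natCard_hull_mul_natCard_isExtVector hK (hℓ.le.trans ℓ.le_succ)
  have h2 := natCard_isExtVector hK D (ℓ + 1)
  rw [natCard_submodule hK, natCard_submodule hK, hℓ] at h1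
  rw [natCard_submodule hK, hℓ] at hsplit
  zify at h1 hsplit
  rw [h2, eq_sub_of_add_eq hsplit] at h1
  have hq0 : (q : ℤ) ≠ 0 := by positivity
  apply mul_left_cancel₀ (pow_ne_zero (finrank K D) (pow_ne_zero 2 hq0))
  apply mul_left_cancel₀ (pow_ne_zero ℓ (pow_ne_zero 2 hq0))
  have hsign : ((-1 : ℤ) ^ b) * (-1) ^ b = 1 := by rw [← mul_pow]; simp
  linear_combination (q : ℤ) * h1 + ((q : ℤ) ^ 2) ^ finrank K D * hN +
    ((q : ℤ) ^ 2) ^ finrank K D * ((q : ℤ) ^ 2) ^ ℓ * q * hsign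

/-- The number of extensions that shrink the hull: they are spanned over `D` by the vectors
outside `(hull D)^⊥`. -/
theorem numExt_pred (hK : Fintype.card K = q ^ 2) (hℓ : finrank K (hermHull hK D) = ℓ + 1)
    (hn : finrank K D + (ℓ + 1) + b = n) :
    ((q : ℤ) ^ 2 - 1) * numExt hK D ℓ = (q ^ 2) ^ b * ((q ^ 2) ^ (ℓ + 1) - 1) := by
  have hq := two_le_of_card_eq_sq hK
  have hdual := finrank_add_finrank_hermDual hK (hermHull hK D)
  have hiff : ∀ v, IsExtVector hK D ℓ v ↔ v ∉ hermDual hK (hermHull hK D) := by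
    intro v
    constructor
    · intro hv hv'
      rw [hermDual_hermHull] at hv'
      obtain ⟨d, hd, w, hw, rfl⟩ := Submodule.mem_sup.1 hv'
      rw [isExtVector_add_iff hK hd] at hv
      by_cases hww : hermInner q w w = 0
      · have h := ((isExtVector_succ_iff hK hw).2 ⟨hww, fun h => hv.1 h.1⟩).2
        have := hv.2
        omega
      · have h := ((isExtVector_iff hK hw).2 hww).2
        have := hv.2
        omega
    · intro hv
      refine ⟨fun h => hv ?_, ?_⟩
      · rw [hermDual_hermHull]
        exact Submodule.mem_sup_left h
      · have h1 := finrank_inf_hermDual_span_of_notMem hK hv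
        rw [← hermHull_sup_span_of_notMem hK hv] at h1
        omega
  have hsplit : Nat.card {v // IsExtVector hK D ℓ v} +
      Nat.card (hermDual hK (hermHull hK D)) = (q ^ 2) ^ n := by
    have hV : Nat.card (Fin n → K) = (q ^ 2) ^ n := by
      rw [natCard_eq_pow_finrank (K := K), finrank_fin_fun, Nat.card_eq_fintype_card, hK]
    rw [← hV, ← Nat.card_congr (Equiv.subtypeUnivEquiv (p := fun _ : Fin n → K => True)
      fun _ => trivial)]
    exact natCard_add_natCard_of_iff (Q := (· ∈ hermDual hK (hermHull hK D)))
      (fun v => by rw [hiff]; exact iff_of_true trivial (em' _)) fun v h => (hiff v).1 h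
  have h2 := natCard_isExtVector hK D ℓ
  rw [natCard_submodule hK, show finrank K (hermDual hK (hermHull hK D)) = finrank K D + b by omega]
    at hsplit
  zify at hsplit
  have hpow : ((q : ℤ) ^ 2) ^ n = (q ^ 2) ^ (finrank K D + (ℓ + 1) + b) := by rw [hn]
  rw [eq_sub_of_add_eq hsplit, hpow] at h2
  have hq0 : (q : ℤ) ≠ 0 := by positivity
  apply mul_left_cancel₀ (pow_ne_zero (finrank K D) (pow_ne_zero 2 hq0))
  linear_combination -h2

/-! ### The ratio of consecutive counts -/

/-- The codes covered by `C` with hull of dimension `ℓ` are the Hermitian duals of the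
extensions of `C^⊥` with hull of dimension `ℓ`. -/
theorem natCard_hyperplanes (hK : Fintype.card K = q ^ 2) {k ℓ : ℕ}
    {C : Submodule K (Fin n → K)} (hC : finrank K C = k + 1) :
    Nat.card {D : {D : Submodule K (Fin n → K) //
      finrank K D = k ∧ finrank K (hermHull hK D) = ℓ} // D.1 ≤ C} =
      numExt hK (hermDual hK C) ℓ := by
  have hCn := finrank_add_finrank_hermDual hK C
  refine Nat.card_congr (Equiv.ofBijective (fun D => ⟨hermDual hK D.1.1, ?_, ?_, ?_⟩) ⟨?_, ?_⟩)
  · exact hermDual_anti hK D.2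
  · have := finrank_add_finrank_hermDual hK D.1.1
    have := D.1.2.1
    omega
  · rw [hermHull_hermDual, D.1.2.2]
  · rintro ⟨⟨D, h1⟩, h2⟩ ⟨⟨D', h1'⟩, h2'⟩ h
    have h' := congrArg (hermDual hK) (congrArg Subtype.val h)
    simp only [hermDual_hermDual] at h'
    subst h'
    rfl
  · rintro ⟨E, h1, h2, h3⟩
    have hE := finrank_add_finrank_hermDual hK E
    refine ⟨⟨⟨hermDual hK E, by omega, by rw [hermHull_hermDual, h3]⟩, ?_⟩, ?_⟩
    · rw [← hermDual_le_hermDual hK, hermDual_hermDual]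
      exact h1
    · exact Subtype.ext (hermDual_hermDual hK E)

/-- Double counting of the pairs `D < C` with `C` of dimension `k + 1` and hull dimension `j`, and
`D` of dimension `k` and hull dimension `ℓ`. The factors `c₁` and `c₂` clear the denominators in
the two numbers of extensions. -/
theorem numCodes_mul_eq (hK : Fintype.card K = q ^ 2) {k ℓ j : ℕ} {c₁ c₂ s u : ℤ}
    (hs : ∀ D : Submodule K (Fin n → K), finrank K D = k → finrank K (hermHull hK D) = ℓ →
      c₁ * numExt hK D j = s)
    (hu : ∀ C : Submodule K (Fin n → K), finrank K C = k + 1 → finrank K (hermHull hK C) = j →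
      c₂ * numExt hK (hermDual hK C) ℓ = u) :
    c₂ * (numCodes hK n k ℓ * s) = c₁ * (numCodes hK n (k + 1) j * u) := by
  classical
  let 𝒟 := {D : Submodule K (Fin n → K) // finrank K D = k ∧ finrank K (hermHull hK D) = ℓ}
  let 𝒞 := {C : Submodule K (Fin n → K) // finrank K C = k + 1 ∧ finrank K (hermHull hK C) = j}
  have : Fintype 𝒟 := Fintype.ofFinite _
  have : Fintype 𝒞 := Fintype.ofFinite _
  have hpairs : ∑ D : 𝒟, Nat.card {C : 𝒞 // D.1 ≤ C.1} =
      ∑ C : 𝒞, Nat.card {D : 𝒟 // D.1 ≤ C.1} := by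
    rw [← Nat.card_sigma, ← Nat.card_sigma]
    exact Nat.card_congr
      ⟨fun p => ⟨p.2.1, p.1, p.2.2⟩, fun p => ⟨p.2.1, p.1, p.2.2⟩, fun _ => rfl, fun _ => rfl⟩
  have hext : ∀ D : 𝒟, Nat.card {C : 𝒞 // D.1 ≤ C.1} = numExt hK D.1 j := by
    rintro ⟨D, hD, hD'⟩
    exact Nat.card_congr
      ⟨fun C => ⟨C.1.1, C.2, C.1.2.1.trans (congrArg (· + 1) hD.symm), C.1.2.2⟩,
        fun C => ⟨⟨C.1, C.2.2.1.trans (congrArg (· + 1) hD), C.2.2.2⟩, C.2.1⟩, fun _ => rfl, fun _ => rfl⟩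
  have h1 : c₁ * ((∑ D : 𝒟, Nat.card {C : 𝒞 // D.1 ≤ C.1} : ℕ) : ℤ) = numCodes hK n k ℓ * s := by
    rw [Nat.cast_sum, Finset.mul_sum, Finset.sum_congr rfl fun D _ => by
      rw [hext D, hs D.1 D.2.1 D.2.2], Finset.sum_const, nsmul_eq_mul, Finset.card_univ,
      ← Nat.card_eq_fintype_card]
    rfl
  have h2 : c₂ * ((∑ C : 𝒞, Nat.card {D : 𝒟 // D.1 ≤ C.1} : ℕ) : ℤ) =
      numCodes hK n (k + 1) j * u := by
    rw [Nat.cast_sum, Finset.mul_sum, Finset.sum_congr rfl fun C _ => by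
      rw [natCard_hyperplanes hK C.2.1, hu C.1 C.2.1 C.2.2], Finset.sum_const, nsmul_eq_mul,
      Finset.card_univ, ← Nat.card_eq_fintype_card]
    rfl
  rw [← h1, ← h2, hpairs]
  ring

/-- The ratio decomposition with denominators cleared, for `a = k - ℓ` and `b = n - k - ℓ`.
Both counts are compared with the number of codes of dimension `k - 1` and hull dimension `ℓ`. -/
theorem numCodes_ratio (hK : Fintype.card K = q ^ 2) {ℓ a b : ℕ}
    (hn : n = 2 * ℓ + (a + 1) + (b + 1)) :
    (numCodes hK n (ℓ + a + 1) ℓ : ℤ) *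
        ((q ^ (a + 1) - (-1) ^ (a + 1)) * (q ^ (b + 1) - (-1) ^ (b + 1))) =
      numCodes hK n (ℓ + a + 1) (ℓ + 1) * (q ^ (a + b + 1) * ((q ^ 2) ^ (ℓ + 1) - 1)) := by
  have hq := two_le_of_card_eq_sq hK
  have hq2 : (2 : ℤ) ≤ q := by exact_mod_cast hq
  have h1 := numCodes_mul_eq (n := n) hK (k := ℓ + a) (ℓ := ℓ) (j := ℓ)
    (fun D hD hD' => numExt_same (b := b + 2) hK hD' (by omega))
    (fun C hC hC' => numExt_same (b := a + 1) hK (by rw [hermHull_hermDual, hC']) (by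
        have := finrank_add_finrank_hermDual hK C
        omega))
  have h2 := numCodes_mul_eq (n := n) hK (k := ℓ + a) (ℓ := ℓ) (j := ℓ + 1)
    (fun D hD hD' => numExt_succ (b := b + 2) hK hD' (by omega))
    (fun C hC hC' => numExt_pred (b := a) hK (by rw [hermHull_hermDual, hC']) (by
        have := finrank_add_finrank_hermDual hK C
        omega))
  have hq0 : (q : ℤ) ≠ 0 := by omega
  have h1' := mul_left_cancel₀ (mul_ne_zero hq0 (by omega : (q : ℤ) + 1 ≠ 0)) h1
  have hsq : (q : ℤ) ^ 2 - 1 ≠ 0 := by nlinarith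
  rw [mul_comm (q : ℤ) (_ - 1), mul_assoc] at h2
  have h2' := mul_left_cancel₀ hsq h2
  apply mul_left_cancel₀ (pow_ne_zero (a + 2) hq0)
  -- the common count of the codes `D` is eliminated by these multipliers, because
  -- `q ^ (b + 2) + q (-1) ^ (b + 2) = q (q ^ (b + 1) - (-1) ^ (b + 1))`
  linear_combination -(q * (q ^ (b + 1) - (-1) ^ (b + 1)) : ℤ) * h1' + (q : ℤ) ^ (b + 2) * h2'

/-! ### The ratio factor -/

theorem alphaH_denominator_pos {x : ℝ} (hx : 1 < x) (a : ℕ) :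
    0 < x ^ (a + 1) - (-1) ^ (a + 1) := by
  have h1 : 1 < x ^ (a + 1) := one_lt_pow₀ hx a.succ_ne_zero
  rcases neg_one_pow_eq_or ℝ (a + 1) with h | h <;> rw [h] <;> linarith

/-- The ratio factor for `k - ℓ = a + 1` and `n - k - ℓ = b + 1`, without truncated subtraction. -/
theorem alphaH_eq (q ℓ a b : ℕ) :
    alphaH (2 * ℓ + (a + 1) + (b + 1)) (ℓ + a + 1) ℓ q =
      (q : ℝ) ^ (a + b + 1) * ((q : ℝ) ^ (ℓ + 1) + 1) /
        (((q : ℝ) ^ (a + 1) - (-1) ^ (a + 1)) * ((q : ℝ) ^ (b + 1) - (-1) ^ (b + 1))) := by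
  rw [alphaH, show 2 * ℓ + (a + 1) + (b + 1) - 2 * ℓ - 1 = a + b + 1 by omega,
    show ℓ + a + 1 - ℓ = a + 1 by omega,
    show 2 * ℓ + (a + 1) + (b + 1) - (ℓ + a + 1) - ℓ = b + 1 by omega]

theorem one_lt_alphaH_add {q : ℕ} (hq : 2 ≤ q) {ℓ a b : ℕ}
    (h : ¬ (ℓ = 0 ∧ Even (a + b) ∧ (a = 0 ∨ b = 0))) :
    1 < alphaH (2 * ℓ + (a + 1) + (b + 1)) (ℓ + a + 1) ℓ q := by
  have hQ : (2 : ℝ) ≤ q := by exact_mod_cast hq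
  rw [alphaH_eq, one_lt_div (mul_pos (alphaH_denominator_pos (by linarith) a)
    (alphaH_denominator_pos (by linarith) b))]
  have hx : (1 : ℝ) ≤ (q : ℝ) ^ a := one_le_pow₀ (by linarith)
  have hy : (1 : ℝ) ≤ (q : ℝ) ^ b := one_le_pow₀ (by linarith)
  have hxy : 0 ≤ ((q : ℝ) ^ a - 1) * ((q : ℝ) ^ b - 1) := by nlinarith
  rw [pow_succ (q : ℝ) a, pow_succ (q : ℝ) b, pow_succ (q : ℝ) (a + b), pow_add (q : ℝ) a b,
    pow_succ (-1 : ℝ) a, pow_succ (-1 : ℝ) b]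
  rcases Nat.eq_zero_or_pos ℓ with rfl | hℓ
  · rw [zero_add, pow_one]
    rcases Nat.even_or_odd a with ha | ha <;> rcases Nat.even_or_odd b with hb | hb
    · -- `k - ℓ` and `n - k - ℓ` are both odd, and at least `3` outside the exceptional family
      have ha2 : 2 ≤ a := by
        have h0 : a ≠ 0 := fun h0 => h ⟨rfl, ha.add hb, Or.inl h0⟩
        obtain ⟨c, rfl⟩ := ha
        omega
      have hb2 : 2 ≤ b := by
        have h0 : b ≠ 0 := fun h0 => h ⟨rfl, ha.add hb, Or.inr h0⟩
        obtain ⟨c, rfl⟩ := hb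
        omega
      have hx4 : (4 : ℝ) ≤ (q : ℝ) ^ a :=
        le_trans (by nlinarith) (pow_le_pow_right₀ (by linarith : (1 : ℝ) ≤ q) ha2)
      have hy4 : (4 : ℝ) ≤ (q : ℝ) ^ b :=
        le_trans (by nlinarith) (pow_le_pow_right₀ (by linarith : (1 : ℝ) ≤ q) hb2)
      rw [ha.neg_one_pow, hb.neg_one_pow]
      have h4 : (q : ℝ) ^ a * q ^ b ≥ 2 * q ^ a + 2 * q ^ b := by nlinarith
      have h5 := mul_le_mul_of_nonneg_left h4 (by linarith : (0 : ℝ) ≤ q)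
      nlinarith
    · rw [ha.neg_one_pow, hb.neg_one_pow]
      nlinarith [mul_nonneg (by linarith : (0 : ℝ) ≤ q) hxy]
    · rw [ha.neg_one_pow, hb.neg_one_pow]
      nlinarith [mul_nonneg (by linarith : (0 : ℝ) ≤ q) hxy]
    · rw [ha.neg_one_pow, hb.neg_one_pow]
      nlinarith [mul_nonneg (by linarith : (0 : ℝ) ≤ q) hxy]
  · have hsq : (q : ℝ) ^ 2 ≤ (q : ℝ) ^ (ℓ + 1) :=
      pow_le_pow_right₀ (by linarith) (by omega)
    generalize hx' : (q : ℝ) ^ a = x at *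
    generalize hy' : (q : ℝ) ^ b = y at *
    generalize (q : ℝ) = Q at *
    have hε : ∀ c : ℕ, (-1 : ℝ) ≤ (-1) ^ c := fun c => by
      rcases neg_one_pow_eq_or ℝ c with h | h <;> rw [h] <;> norm_num
    have hε' : ∀ c : ℕ, (-1 : ℝ) ^ c ≤ 1 := fun c => by
      rcases neg_one_pow_eq_or ℝ c with h | h <;> rw [h] <;> norm_num
    have hQx : 1 ≤ Q * x := by nlinarith
    have hQy : 1 ≤ Q * y := by nlinarith
    have hxy1 : 1 ≤ x * y := by nlinarith
    -- replace both signs by the worst case and use `(x - 1) (y - 1) ≥ 0`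
    calc (x * Q - (-1) ^ a * -1) * (y * Q - (-1) ^ b * -1)
        ≤ (x * Q + 1) * (y * Q + 1) := by
          apply mul_le_mul <;> nlinarith [hε a, hε b, hε' a, hε' b]
      _ < x * y * Q * (Q ^ 2 + 1) := by
          have h1 := mul_nonneg (by linarith : (0 : ℝ) ≤ Q) hxy
          have h2 : 0 ≤ (x * y - 1) * Q ^ 2 := by nlinarith
          have h3 : 0 ≤ (Q - 2) * (x * y * Q ^ 2) := by
            apply mul_nonneg (by linarith)
            positivity
          nlinarith
      _ ≤ x * y * Q * (Q ^ (ℓ + 1) + 1) := by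
          apply mul_le_mul_of_nonneg_left (by linarith)
          positivity

theorem alphaH_add_of_boundary {q : ℕ} (hq : 2 ≤ q) {a b : ℕ} (hab : Even (a + b))
    (h0 : a = 0 ∨ b = 0) :
    alphaH (2 * 0 + (a + 1) + (b + 1)) (0 + a + 1) 0 q =
      (q : ℝ) ^ max (a + 1) (b + 1) / ((q : ℝ) ^ max (a + 1) (b + 1) + 1) := by
  have hQ : (2 : ℝ) ≤ q := by exact_mod_cast hq
  rw [alphaH_eq]
  rcases h0 with rfl | rfl
  · rw [zero_add] at hab
    rw [max_eq_right (by omega), pow_succ (-1 : ℝ) b, hab.neg_one_pow, div_eq_div_iff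
      (by norm_num; exact ⟨by positivity, by positivity⟩) (by positivity)]
    ring
  · rw [add_zero] at hab
    rw [max_eq_left (by omega), pow_succ (-1 : ℝ) a, hab.neg_one_pow, div_eq_div_iff
      (by norm_num; exact ⟨by positivity, by positivity⟩) (by positivity)]
    ring

/-! ### Parity check matrices and ebits -/

theorem hermInner_conjTranspose_mulVec (hK : Fintype.card K = q ^ 2)
    (H : Matrix (Fin r) (Fin n) K) (x : Fin n → K) (z : Fin r → K) :
    hermInner q x ((H.map (fun a => a ^ q)).transpose.mulVec z) =
      H.mulVec x ⬝ᵥ fun j => z j ^ q := by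
  have h : ∀ i, (H.map (fun a => a ^ q)).transpose.mulVec z i ^ q = ∑ j, H j i * z j ^ q := by
    intro i
    rw [← conjHom_apply hK, Matrix.mulVec, dotProduct, map_sum]
    refine Finset.sum_congr rfl fun j _ => ?_
    rw [map_mul, conjHom_apply, conjHom_apply, Matrix.transpose_apply, Matrix.map_apply,
      pow_pow_of_card_eq_sq hK]
  simp only [hermInner, h]
  simp only [Matrix.mulVec, dotProduct, Finset.mul_sum, Finset.sum_mul]
  rw [Finset.sum_comm]
  exact Finset.sum_congr rfl fun j _ => Finset.sum_congr rfl fun i _ => by ring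

/-- `H†` maps injectively onto `C^⊥`, and it identifies the kernel of `H H†` with the hull. -/
theorem ebits_add_finrank (hK : Fintype.card K = q ^ 2) {C : Submodule K (Fin n → K)}
    {H : Matrix (Fin r) (Fin n) K} (hH : IsParityCheck H C) :
    ebits q H + finrank K C + finrank K (hermHull hK C) = n := by
  have hrank : finrank K H.mulVecLin.range = r := by
    have := hH.1.rank_matrix
    rwa [Fintype.card_fin] at this
  have hker : H.mulVecLin.ker = C := by
    ext x
    rw [LinearMap.mem_ker, Matrix.mulVecLin_apply, hH.2 x]
  have hrn := H.mulVecLin.finrank_range_add_finrank_ker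
  rw [hrank, hker, finrank_fin_fun] at hrn
  have hsurj : Function.Surjective H.mulVecLin := by
    rw [← LinearMap.range_eq_top]
    exact Submodule.eq_top_of_finrank_eq (by rw [hrank, finrank_fin_fun])
  set Hd : Matrix (Fin n) (Fin r) K := (H.map (fun a => a ^ q)).transpose with hHd
  have hinj : Function.Injective Hd.mulVecLin := by
    rw [← LinearMap.ker_eq_bot, LinearMap.ker_eq_bot']
    intro z hz
    funext j
    obtain ⟨x, hx⟩ := hsurj (Pi.single j 1)
    have h := hermInner_conjTranspose_mulVec hK H x z
    rw [← hHd, ← Matrix.mulVecLin_apply, hz, ← Matrix.mulVecLin_apply, hx,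
      single_one_dotProduct, (hermInner_eq_zero_comm hK).1 (by simp [hermInner])] at h
    exact pow_eq_zero_iff (pos_of_card_eq_sq hK) |>.1 h.symm
  have hdual := finrank_add_finrank_hermDual hK C
  have hrange : Hd.mulVecLin.range = hermDual hK C := by
    apply Submodule.eq_of_le_of_finrank_eq
    · rintro _ ⟨z, rfl⟩ x hx
      rw [Matrix.mulVecLin_apply, hHd, hermInner_conjTranspose_mulVec hK, (hH.2 x).1 hx,
        zero_dotProduct]
    · rw [LinearMap.finrank_range_of_inj hinj, finrank_fin_fun]
      omega
  have hmap : (H * Hd).mulVecLin.ker.map Hd.mulVecLin = hermHull hK C := by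
    rw [Matrix.mulVecLin_mul, LinearMap.ker_comp, hker, Submodule.map_comap_eq, hrange, hermHull,
      inf_comm]
  have hfin : finrank K (H * Hd).mulVecLin.ker = finrank K (hermHull hK C) := by
    rw [← hmap]
    exact (Submodule.equivMapOfInjective _ hinj _).finrank_eq
  have hrn' := (H * Hd).mulVecLin.finrank_range_add_finrank_ker
  rw [hfin, finrank_fin_fun] at hrn'
  have : ebits q H = finrank K (H * Hd).mulVecLin.range := rfl
  omega

omit [Fintype K] in
theorem exists_isParityCheck {C : Submodule K (Fin n → K)} (hC : finrank K C + r = n) :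
    ∃ H : Matrix (Fin r) (Fin n) K, IsParityCheck H C := by
  have hquot := C.finrank_quotient_add_finrank
  rw [finrank_fin_fun] at hquot
  let e : ((Fin n → K) ⧸ C) ≃ₗ[K] (Fin r → K) :=
    LinearEquiv.ofFinrankEq _ _ (by rw [finrank_fin_fun]; omega)
  let g : (Fin n → K) →ₗ[K] (Fin r → K) := e.toLinearMap ∘ₗ C.mkQ
  have hg : ∀ x, (LinearMap.toMatrix' g).mulVec x = g x := fun x => by
    rw [← Matrix.toLin'_apply, Matrix.toLin'_toMatrix']
  refine ⟨LinearMap.toMatrix' g, ?_, fun x => ?_⟩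
  · rw [← Matrix.vecMul_injective_iff]
    intro v w hvw
    refine dotProduct_eq _ _ fun y => ?_
    obtain ⟨x, rfl⟩ : ∃ x, g x = y := (e.surjective.comp C.mkQ_surjective) y
    rw [← hg, Matrix.dotProduct_mulVec, Matrix.dotProduct_mulVec]
    exact congrArg (· ⬝ᵥ x) hvw
  · rw [hg]
    simp [g]

theorem numCodesEbits_eq_numCodes (hK : Fintype.card K = q ^ 2) {k ℓ c : ℕ} (h : c + k + ℓ = n) :
    numCodesEbits K q n k c = numCodes hK n k ℓ := by
  unfold numCodesEbits numCodes
  congr 1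
  ext C
  refine and_congr_right fun hC => ⟨?_, fun hℓ => ?_⟩
  · rintro ⟨H, hH, rfl⟩
    have := ebits_add_finrank hK hH
    omega
  · obtain ⟨H, hH⟩ := exists_isParityCheck (r := n - k) (C := C) (by omega)
    have := ebits_add_finrank hK hH
    exact ⟨H, hH, by omega⟩

/-! ### Bounds on the ratio, positivity and monotonicity -/

theorem numCodes_eq_alphaH_mul (hK : Fintype.card K = q ^ 2) {ℓ k : ℕ} (hk : ℓ + 1 ≤ k)
    (hkn : k + ℓ + 1 ≤ n) :
    (numCodes hK n k ℓ : ℝ) = alphaH n k ℓ q * ((q : ℝ) ^ (ℓ + 1) - 1) *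
      (numCodes hK n k (ℓ + 1) : ℝ) := by
  obtain ⟨a, rfl⟩ : ∃ a, k = ℓ + a + 1 := ⟨k - ℓ - 1, by omega⟩
  obtain ⟨b, rfl⟩ : ∃ b, n = 2 * ℓ + (a + 1) + (b + 1) :=
    ⟨n - (2 * ℓ + (a + 1) + 1), by omega⟩
  have hQ : (2 : ℝ) ≤ q := by exact_mod_cast two_le_of_card_eq_sq hK
  have ha := alphaH_denominator_pos (by linarith : (1 : ℝ) < q) a
  have hb := alphaH_denominator_pos (by linarith : (1 : ℝ) < q) b
  have h := congrArg (Int.cast (R := ℝ)) (numCodes_ratio hK (ℓ := ℓ) (a := a) (b := b) rfl)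
  push_cast at h
  rw [alphaH_eq, div_mul_eq_mul_div, div_mul_eq_mul_div, eq_div_iff (mul_pos ha hb).ne', h]
  ring

theorem alphaH_of_boundary (hq : 2 ≤ q) {k : ℕ} (hk : 1 ≤ k) (hkn : k + 1 ≤ n)
    (hn : Even n) (hk' : k = 1 ∨ k = n - 1) :
    alphaH n k 0 q = (q : ℝ) ^ max k (n - k) / ((q : ℝ) ^ max k (n - k) + 1) := by
  obtain ⟨a, rfl⟩ : ∃ a, k = 0 + a + 1 := ⟨k - 1, by omega⟩
  obtain ⟨b, rfl⟩ : ∃ b, n = 2 * 0 + (a + 1) + (b + 1) := ⟨n - (a + 2), by omega⟩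
  have hab : Even (a + b) := by
    obtain ⟨c, hc⟩ := hn
    exact ⟨c - 1, by omega⟩
  rw [alphaH_add_of_boundary hq hab (by omega)]
  rw [show 2 * 0 + (a + 1) + (b + 1) - (0 + a + 1) = b + 1 by omega, zero_add]

theorem one_lt_alphaH (hq : 2 ≤ q) {ℓ k : ℕ} (hk : ℓ + 1 ≤ k) (hkn : k + ℓ + 1 ≤ n)
    (h : ¬ (ℓ = 0 ∧ Even n ∧ (k = 1 ∨ k = n - 1))) : 1 < alphaH n k ℓ q := by
  obtain ⟨a, rfl⟩ : ∃ a, k = ℓ + a + 1 := ⟨k - ℓ - 1, by omega⟩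
  obtain ⟨b, rfl⟩ : ∃ b, n = 2 * ℓ + (a + 1) + (b + 1) :=
    ⟨n - (2 * ℓ + (a + 1) + 1), by omega⟩
  refine one_lt_alphaH_add hq fun ⟨hℓ, ⟨c, hc⟩, h0⟩ => h ⟨hℓ, ⟨ℓ + c + 1, by omega⟩, by omega⟩

theorem div_add_one_le_alphaH (hq : 2 ≤ q) {ℓ k : ℕ} (hk : ℓ + 1 ≤ k) (hkn : k + ℓ + 1 ≤ n) :
    (q : ℝ) / (q + 1) ≤ alphaH n k ℓ q := by
  have hQ : (2 : ℝ) ≤ q := by exact_mod_cast hq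
  by_cases h : ℓ = 0 ∧ Even n ∧ (k = 1 ∨ k = n - 1)
  · obtain ⟨rfl, hn, hk'⟩ := h
    rw [alphaH_of_boundary hq hk hkn hn hk', div_le_div_iff₀ (by positivity) (by positivity)]
    have : (q : ℝ) ≤ (q : ℝ) ^ max k (n - k) :=
      le_self_pow₀ (by linarith) (by omega)
    nlinarith
  · refine le_trans ?_ (one_lt_alphaH hq hk hkn h).le
    rw [div_le_one (by positivity)]
    linarith

theorem finrank_hermHull_add_le (hK : Fintype.card K = q ^ 2) (C : Submodule K (Fin n → K)) :
    finrank K (hermHull hK C) ≤ finrank K C ∧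
      finrank K C + finrank K (hermHull hK C) ≤ n := by
  have h1 : finrank K (hermHull hK C) ≤ finrank K C := Submodule.finrank_mono inf_le_left
  have h2 : finrank K (hermHull hK C) ≤ finrank K (hermDual hK C) :=
    Submodule.finrank_mono inf_le_right
  have := finrank_add_finrank_hermDual hK C
  omega

/-- By the ratio decomposition the counts for two consecutive hull dimensions vanish together, and
some code of dimension `k` exists. -/
theorem numCodes_pos (hK : Fintype.card K = q ^ 2) {ℓ k : ℕ} (hk : ℓ ≤ k) (hkn : k + ℓ ≤ n) :
    0 < numCodes hK n k ℓ := by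
  have hq := two_le_of_card_eq_sq hK
  have hQ : (2 : ℝ) ≤ q := by exact_mod_cast hq
  have hstep : ∀ m, m + 1 ≤ k → k + m + 1 ≤ n →
      (numCodes hK n k m = 0 ↔ numCodes hK n k (m + 1) = 0) := by
    intro m hm hmn
    have hα : 0 < alphaH n k m q :=
      lt_of_lt_of_le (by positivity) (div_add_one_le_alphaH hq hm hmn)
    have hpow : (1 : ℝ) < (q : ℝ) ^ (m + 1) := one_lt_pow₀ (by linarith) m.succ_ne_zero
    have h := numCodes_eq_alphaH_mul hK hm hmn
    rw [← Nat.cast_eq_zero (R := ℝ), h, mul_eq_zero, or_iff_right, Nat.cast_eq_zero]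
    exact (mul_pos hα (by linarith)).ne'
  have hall : ∀ m, m ≤ k → k + m ≤ n → (numCodes hK n k m = 0 ↔ numCodes hK n k 0 = 0) := by
    intro m
    induction m with
    | zero => exact fun _ _ => Iff.rfl
    | succ m ih => exact fun hm hmn => (hstep m hm hmn).symm.trans (ih (by omega) (by omega))
  rw [Nat.pos_iff_ne_zero, Ne, hall ℓ hk hkn]
  intro h0
  obtain ⟨C, hC⟩ : ∃ C : Submodule K (Fin n → K), finrank K C = k := by
    have hli := (Pi.basisFun K (Fin n)).linearIndependent.comp (Fin.castLE (by omega : k ≤ n))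
      (Fin.castLE_injective _)
    exact ⟨_, (finrank_span_eq_card hli).trans (Fintype.card_fin k)⟩
  obtain ⟨h1, h2⟩ := finrank_hermHull_add_le hK C
  rw [hC] at h1 h2
  have h3 := (hall _ h1 h2).2 h0
  rw [numCodes, Set.ncard_eq_zero] at h3
  exact (h3.subset ⟨hC, rfl⟩ : C ∈ (∅ : Set _))

theorem numCodes_succ_lt (hK : Fintype.card K = q ^ 2) {ℓ k : ℕ} (hk : ℓ + 1 ≤ k)
    (hkn : k + ℓ + 1 ≤ n) (h : ¬ (q = 2 ∧ ℓ = 0 ∧ Even n ∧ (k = 1 ∨ k = n - 1))) :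
    numCodes hK n k (ℓ + 1) < numCodes hK n k ℓ := by
  have hq := two_le_of_card_eq_sq hK
  have hQ : (2 : ℝ) ≤ q := by exact_mod_cast hq
  have hfactor : 1 < alphaH n k ℓ q * ((q : ℝ) ^ (ℓ + 1) - 1) := by
    by_cases hex : ℓ = 0 ∧ Even n ∧ (k = 1 ∨ k = n - 1)
    · -- here the ratio is at least `q (q - 1) / (q + 1)`, which exceeds `1` exactly for `q ≥ 3`
      obtain ⟨rfl, hex⟩ := hex
      have hq3 : 3 ≤ q := by
        have : q ≠ 2 := fun h2 => h ⟨h2, rfl, hex⟩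
        omega
      have hQ3 : (3 : ℝ) ≤ q := by exact_mod_cast hq3
      calc (1 : ℝ) < q / (q + 1) * (q ^ (0 + 1) - 1) := by
            rw [zero_add, pow_one, div_mul_eq_mul_div, one_lt_div (by positivity)]
            nlinarith
        _ ≤ _ := by
            apply mul_le_mul_of_nonneg_right (div_add_one_le_alphaH hq hk hkn)
            rw [zero_add, pow_one]
            linarith
    · have h1 := one_lt_alphaH hq hk hkn hex
      have h2 : (q : ℝ) ≤ (q : ℝ) ^ (ℓ + 1) := le_self_pow₀ (by linarith) ℓ.succ_ne_zero
      nlinarith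
  have hpos : (0 : ℝ) < numCodes hK n k (ℓ + 1) := by
    exact_mod_cast numCodes_pos hK hk (by omega)
  rw [← Nat.cast_lt (α := ℝ), numCodes_eq_alphaH_mul hK hk hkn]
  exact lt_mul_of_one_lt_left hpos hfactor

theorem numCodes_strictAntiOn (hK : Fintype.card K = q ^ 2) {k : ℕ}
    (h : ¬ (q = 2 ∧ Even n ∧ (k = 1 ∨ k = n - 1))) :
    StrictAntiOn (fun ℓ : ℕ => numCodes hK n k ℓ) {ℓ : ℕ | ℓ ≤ k ∧ k + ℓ ≤ n} := by
  rintro ℓ - m ⟨hm, hmn⟩ hlt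
  simp only
  induction m, hlt using Nat.le_induction with
  | base => exact numCodes_succ_lt hK hm hmn fun h' => h ⟨h'.1, h'.2.2⟩
  | succ m hlt ih =>
    exact (numCodes_succ_lt hK hm hmn fun h' => h ⟨h'.1, h'.2.2⟩).trans
      (ih (by omega) (by omega))

end HermitianCode

theorem corollary5p4 {K : Type*} [Field K] [Fintype K] (q : ℕ)
    (hK : Fintype.card K = q ^ 2) (n k : ℕ) (hk : 1 ≤ k) (hkn : k + 1 ≤ n) :
    -- a code with Hermitian hull dimension `ℓ` needs exactly `c = n - k - ℓ` ebits,
    -- whichever parity check matrix is used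
    (∀ (C : Submodule K (Fin n → K)) (H : Matrix (Fin (n - k)) (Fin n) K),
      Module.finrank K C = k → HermitianCode.IsParityCheck H C →
        HermitianCode.ebits q H + k + Module.finrank K (HermitianCode.hermHull hK C) = n) ∧
    -- hence the counts by hull dimension are the counts by number of ebits
    (∀ ℓ c : ℕ, c + k + ℓ = n →
      HermitianCode.numCodesEbits K q n k c = HermitianCode.numCodes hK n k ℓ) ∧
    -- ratio decomposition, with the bounds on the ratio factor
    (∀ ℓ : ℕ, ℓ + 1 ≤ k → k + ℓ + 1 ≤ n →
      (HermitianCode.numCodes hK n k ℓ : ℝ) =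
        HermitianCode.alphaH n k ℓ q * ((q : ℝ) ^ (ℓ + 1) - 1) *
          (HermitianCode.numCodes hK n k (ℓ + 1) : ℝ) ∧
      (¬ (ℓ = 0 ∧ Even n ∧ (k = 1 ∨ k = n - 1)) → 1 < HermitianCode.alphaH n k ℓ q) ∧
      (ℓ = 0 ∧ Even n ∧ (k = 1 ∨ k = n - 1) →
        HermitianCode.alphaH n k ℓ q =
            (q : ℝ) ^ max k (n - k) / ((q : ℝ) ^ max k (n - k) + 1) ∧
          HermitianCode.alphaH n k ℓ q < 1) ∧
      (q : ℝ) / (q + 1) ≤ HermitianCode.alphaH n k ℓ q ∧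
      (2 : ℝ) / 3 ≤ (q : ℝ) / (q + 1)) ∧
    -- strict monotonicity at every step outside the boundary family
    (∀ ℓ : ℕ, ℓ + 1 ≤ k → k + ℓ + 1 ≤ n →
      ¬ (q = 2 ∧ ℓ = 0 ∧ Even n ∧ (k = 1 ∨ k = n - 1)) →
        HermitianCode.numCodes hK n k (ℓ + 1) < HermitianCode.numCodes hK n k ℓ) ∧
    -- strictly decreasing in `ℓ`, and strictly increasing in `c`, over the whole range
    (¬ (q = 2 ∧ Even n ∧ (k = 1 ∨ k = n - 1)) →
      StrictAntiOn (fun ℓ : ℕ => HermitianCode.numCodes hK n k ℓ)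
        {ℓ : ℕ | ℓ ≤ k ∧ k + ℓ ≤ n} ∧
      StrictMonoOn (fun c : ℕ => HermitianCode.numCodesEbits K q n k c)
        {c : ℕ | ∃ ℓ : ℕ, ℓ ≤ k ∧ c + k + ℓ = n}) := by
  have hq := HermitianCode.two_le_of_card_eq_sq hK
  have hQ : (2 : ℝ) ≤ q := by exact_mod_cast hq
  refine ⟨fun C H hC hH => ?_, fun ℓ c => HermitianCode.numCodesEbits_eq_numCodes hK,
    fun ℓ h1 h2 => ⟨HermitianCode.numCodes_eq_alphaH_mul hK h1 (by omega),
      HermitianCode.one_lt_alphaH hq h1 (by omega), ?_,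
      HermitianCode.div_add_one_le_alphaH hq h1 (by omega), ?_⟩,
    fun ℓ h1 h2 => HermitianCode.numCodes_succ_lt hK h1 (by omega),
    fun h => ⟨HermitianCode.numCodes_strictAntiOn hK h, ?_⟩⟩
  · have := HermitianCode.ebits_add_finrank hK hH
    omega
  · rintro ⟨rfl, hn, hk'⟩
    have hα := HermitianCode.alphaH_of_boundary hq hk hkn hn hk'
    refine ⟨hα, ?_⟩
    rw [hα, div_lt_one (by positivity)]
    linarith
  · rw [div_le_div_iff₀ (by norm_num) (by positivity)]
    linarith
  · rintro c ⟨ℓ, hℓ, hc⟩ c' ⟨ℓ', hℓ', hc'⟩ hcc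
    simp only
    rw [HermitianCode.numCodesEbits_eq_numCodes hK hc,
      HermitianCode.numCodesEbits_eq_numCodes hK hc']
    exact HermitianCode.numCodes_strictAntiOn hK h ⟨hℓ', by omega⟩ ⟨hℓ, by omega⟩ (by omega)
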